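/- Let $s\ge 1$ be an integer and let $G$ be a finite abelian group of order $v=(2^s+1)(2^{2s}+1)$. Let $D\subseteq G$ be a $(v,k,\lambda)$-difference set with $k=2^{2s}+2^s+1$ and $\lambda=2^s+1$ (the parameters of $PG(3,2^s)$); that is, $|D|=k$ and, in the integral group ring $\mathbb{Z}G$, $$\Bigl(\sum_{d\in D} d\Bigr)\Bigl(\sum_{d\in D} d^{-1}\Bigr)=\lambda\sum_{g\in G} g+(k-\lambda)\,1 .$$ Suppose that $D$ is normalized, i.e. $\prod_{d\in D} d=1$. Then $G$ has subgroups $H$ and $K$ with $|H|=2^s+1$ and $|K|=2^{2s}+1$, and for any such $H$ and $K$ the group $G$ is the direct product $G=HK$. Moreover, $H\subseteq D$ and $|D\cap Hx|=1$ for every coset $Hx\ne H$ of $H$ in $G$; furthermore $D\cap K=\{1\}$ and $|D\cap Kx|=2^s+1$ for every coset $Kx\neq K$ of $K$ in $G$. -/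

import Mathlib

open scoped Pointwise

namespace DiffSet

variable {G : Type*} [CommGroup G]

/-- The element `∑_{g ∈ S} g` of the integral group ring `ℤG` attached to a finite subset `S`. -/
noncomputable def groupRingElt (S : Finset G) : MonoidAlgebra ℤ G :=
  ∑ g ∈ S, MonoidAlgebra.single g 1

/-- The map `a = ∑ a_g g ↦ a^{(-1)} = ∑ a_g g⁻¹` on the integral group ring. -/
noncomputable def groupRingInv (a : MonoidAlgebra ℤ G) : MonoidAlgebra ℤ G :=
  MonoidAlgebra.mapDomain (fun g : G => g⁻¹) a

/-- `D` is a `(v, k, l)`-difference set in the finite abelian group `G` of order `v`: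
`D` has `k ≥ 1` elements and `D D^{(-1)} = l G + (k - l) 1` in `ℤG`. -/
structure IsDifferenceSet [Fintype G] (D : Finset G) (v k l : ℕ) : Prop where
  card_group : Fintype.card G = v
  card_set : D.card = k
  pos : 1 ≤ k
  eqn : groupRingElt D * groupRingInv (groupRingElt D) =
    (l : ℤ) • groupRingElt (Finset.univ : Finset G) +
      ((k : ℤ) - (l : ℤ)) • (1 : MonoidAlgebra ℤ G)

/-- `D` is normalized: the product of all its elements is the identity. -/
def IsNormalized (D : Finset G) : Prop :=
  ∏ d ∈ D, d = 1

end DiffSet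

/-! Here `k - λ = 4 ^ s` is a power of 2 and `v` is odd, so 2 is a multiplier: squaring carries `D`
to a translate of itself (`IsDifferenceSet.exists_powHom_eq`). This is proved inside `ℤG`, without
characters: `frobeniusLift_mem_span` shows that the Frobenius lift `g ↦ g ^ 2` preserves
divisibility by `D` modulo powers of 2, and an integral unitary element is `±g`. Normalization and
`gcd(k, v) = 1` make the translation trivial.

Both `G/H` and `G/K` have order `2 ^ m + 1`, so on them inversion is an iterate of squaring and
fixes the image of `D`. Subtracting `c` times the sum of the quotient leaves a fixed element of
square `4 ^ s`, which `eq_intCast_of_sq_eq` shows is an integer. Hence all nontrivial cosets meet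
`D` in `c` points, with `c = 1` for `H` and `c = 2 ^ s + 1` for `K`. -/

namespace DiffSet

/-! ### Lifts of Frobenius on commutative rings -/

section FrobeniusLift

variable {R : Type*} [CommRing R] {p : ℕ} {φ : R →+* R}

theorem dvd_pow_succ_sub_self {c y : R} (h : c ∣ y ^ 2 - y) (j : ℕ) : c ∣ y ^ (j + 1) - y := by
  induction j with
  | zero => simp
  | succ j ih =>
    have : y ^ (j + 1 + 1) - y = y * (y ^ (j + 1) - y) + (y ^ 2 - y) := by ring
    rw [this]
    exact dvd_add (Dvd.dvd.mul_left ih y) h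

theorem dvd_iterate_sub_pow (hφ : ∀ x, (p : R) ∣ φ x - x ^ p) (j : ℕ) (x : R) :
    (p : R) ∣ φ^[j] x - x ^ p ^ j := by
  induction j with
  | zero => simp
  | succ j ih =>
    rw [Function.iterate_succ_apply']
    have h₁ : (p : R) ∣ (φ^[j] x) ^ p - (x ^ p ^ j) ^ p :=
      ih.trans (sub_dvd_pow_sub_pow _ _ _)
    have := dvd_add (hφ (φ^[j] x)) h₁
    rwa [sub_add_sub_cancel, ← pow_mul, ← pow_succ] at this

/-- A lift of Frobenius of finite order maps `x` into the ideal `(x, p ^ N)`. -/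
theorem frobeniusLift_mem_span (hp : p.Prime) (hφ : ∀ x, (p : R) ∣ φ x - x ^ p) {f : ℕ}
    (hf : 1 ≤ f) (hid : ∀ x, φ^[f] x = x) (N : ℕ) (x : R) :
    ∃ a b, φ x = x * a + (p : R) ^ N * b := by
  induction N generalizing x with
  | zero => exact ⟨0, φ x, by simp⟩
  | succ N ih =>
    obtain ⟨r, hr⟩ : ∃ r, p ^ f = r + 2 :=
      ⟨p ^ f - 2, by have := hp.two_le.trans (Nat.le_self_pow (by omega : f ≠ 0) p); omega⟩
    have hx : (p : R) ∣ x ^ (r + 2) - x := by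
      have := dvd_iterate_sub_pow hφ f x
      rw [hid, hr] at this
      simpa using (dvd_neg.2 this)
    -- Since `r + 1 = p ^ f - 1`, `y` is idempotent modulo `p`. Its power `y ^ p ^ N` is a multiple
    -- of `x`, acts as 1 on `x` modulo `p`, and is fixed by `φ` modulo `p ^ (N + 1)`.
    set y := x ^ (r + 1) with hy
    have hyy : (p : R) ∣ y ^ 2 - y := by
      have : y ^ 2 - y = x ^ r * (x ^ (r + 2) - x) := by rw [hy]; ring
      rw [this]
      exact Dvd.dvd.mul_left hx _
    have hpow : ∀ n, 0 < n → (p : R) ∣ y ^ n - y := fun n hn => by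
      obtain ⟨j, rfl⟩ := Nat.exists_eq_succ_of_ne_zero hn.ne'
      exact dvd_pow_succ_sub_self hyy j
    have hφy : (p : R) ∣ φ y - y := by
      have := dvd_add (hφ y) (hpow p hp.pos)
      rwa [sub_add_sub_cancel] at this
    have hφe : (p : R) ^ (N + 1) ∣ φ (y ^ p ^ N) - y ^ p ^ N := by
      rw [map_pow]
      exact dvd_sub_pow_of_dvd_sub hφy N
    have hex : (p : R) ∣ x - y ^ p ^ N * x := by
      have h₁ := Dvd.dvd.mul_right (hpow (p ^ N) (pow_pos hp.pos N)) x
      have h₂ := dvd_neg.2 (dvd_add h₁ hx)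
      have : -((y ^ p ^ N - y) * x + (x ^ (r + 2) - x)) = x - y ^ p ^ N * x := by
        rw [hy]; ring
      rwa [this] at h₂
    obtain ⟨w, hw⟩ := hex
    obtain ⟨c, hc⟩ := hφe
    -- With `e = y ^ p ^ N`, split `x = e * x + p * w`: the first term is handled by `x ∣ e`, and
    -- the factor `p` improves the inductive bound for `w` by one power.
    obtain ⟨a, b, hab⟩ := ih w
    obtain ⟨e', he'⟩ : x ∣ y ^ p ^ N :=
      (dvd_pow_self x (by omega : r + 1 ≠ 0)).trans
        (dvd_pow_self y (pow_pos hp.pos N).ne')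
    refine ⟨e' * φ x + (1 - y ^ p ^ N) * a, c * φ x + b, ?_⟩
    have h₁ := congrArg φ hw
    rw [map_sub, map_mul, map_mul, map_natCast, hab] at h₁
    linear_combination h₁ + φ x * hc + φ x * he' - a * hw

end FrobeniusLift

/-! ### Integral group rings -/

section GroupRing

variable {G : Type*} [CommGroup G]

open MonoidAlgebra

/-- The ring endomorphism `∑ a_g g ↦ ∑ a_g g ^ n` of the integral group ring. -/
noncomputable def powHom (G : Type*) [CommGroup G] (n : ℕ) :
    MonoidAlgebra ℤ G →+* MonoidAlgebra ℤ G :=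
  mapDomainRingHom ℤ (powMonoidHom n : G →* G)

/-- The ring endomorphism `∑ a_g g ↦ ∑ a_g g⁻¹` of the integral group ring. -/
noncomputable def invHom (G : Type*) [CommGroup G] : MonoidAlgebra ℤ G →+* MonoidAlgebra ℤ G :=
  mapDomainRingHom ℤ (invMonoidHom : G →* G)

/-- The augmentation map of the integral group ring. -/
noncomputable def aug (G : Type*) [CommGroup G] : MonoidAlgebra ℤ G →+* ℤ :=
  (lift ℤ ℤ G (1 : G →* ℤ)).toRingHom

theorem groupRingInv_eq (a : MonoidAlgebra ℤ G) : groupRingInv a = invHom G a := rfl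

@[simp] theorem powHom_single (n : ℕ) (g : G) (r : ℤ) :
    powHom G n (single g r) = single (g ^ n) r := by
  simp [powHom]

@[simp] theorem invHom_single (g : G) (r : ℤ) : invHom G (single g r) = single g⁻¹ r := by
  simp [invHom]

@[simp] theorem aug_single (g : G) (r : ℤ) : aug G (single g r) = r := by
  simp [aug]

theorem ringHom_ext_single {S : Type*} [Ring S] {f g : MonoidAlgebra ℤ G →+* S}
    (h : ∀ x, f (single x 1) = g (single x 1)) : f = g := by
  refine MonoidAlgebra.ringHom_ext (fun r => ?_) h
  exact (DFunLike.congr_fun (RingHom.ext_int (f.comp singleOneRingHom)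
    (g.comp singleOneRingHom)) r)

theorem aug_powHom (n : ℕ) (x : MonoidAlgebra ℤ G) : aug G (powHom G n x) = aug G x := by
  have : (aug G).comp (powHom G n) = aug G := ringHom_ext_single fun x => by simp
  exact DFunLike.congr_fun this x

theorem aug_invHom (x : MonoidAlgebra ℤ G) : aug G (invHom G x) = aug G x := by
  have : (aug G).comp (invHom G) = aug G := ringHom_ext_single fun x => by simp
  exact DFunLike.congr_fun this x

theorem invHom_invHom (x : MonoidAlgebra ℤ G) : invHom G (invHom G x) = x := by
  have : (invHom G).comp (invHom G) = RingHom.id _ := ringHom_ext_single fun x => by simp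
  exact DFunLike.congr_fun this x

theorem invHom_powHom (n : ℕ) (x : MonoidAlgebra ℤ G) :
    invHom G (powHom G n x) = powHom G n (invHom G x) := by
  have : (invHom G).comp (powHom G n) = (powHom G n).comp (invHom G) :=
    ringHom_ext_single fun x => by simp
  exact DFunLike.congr_fun this x

theorem powHom_powHom (m n : ℕ) (x : MonoidAlgebra ℤ G) :
    powHom G m (powHom G n x) = powHom G (n * m) x := by
  have : (powHom G m).comp (powHom G n) = powHom G (n * m) :=
    ringHom_ext_single fun x => by simp [pow_mul]
  exact DFunLike.congr_fun this x

theorem powHom_one (x : MonoidAlgebra ℤ G) : powHom G 1 x = x := by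
  have : powHom G 1 = RingHom.id _ := ringHom_ext_single fun x => by simp
  exact DFunLike.congr_fun this x

theorem iterate_powHom (n j : ℕ) (x : MonoidAlgebra ℤ G) :
    (powHom G n)^[j] x = powHom G (n ^ j) x := by
  induction j with
  | zero => simp [powHom_one]
  | succ j ih => rw [Function.iterate_succ_apply', ih, powHom_powHom, pow_succ]

theorem powHom_eq_self_of_forall_pow {n : ℕ} (h : ∀ g : G, g ^ n = g) (x : MonoidAlgebra ℤ G) :
    powHom G n x = x := by
  have : powHom G n = RingHom.id _ := ringHom_ext_single fun x => by simp [h]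
  exact DFunLike.congr_fun this x

theorem powHom_eq_invHom_of_forall_pow {n : ℕ} (h : ∀ g : G, g ^ n = g⁻¹)
    (x : MonoidAlgebra ℤ G) : powHom G n x = invHom G x := by
  have : powHom G n = invHom G := ringHom_ext_single fun x => by simp [h]
  exact DFunLike.congr_fun this x

theorem coeff_intCast_mul (c : ℤ) (x : MonoidAlgebra ℤ G) (g : G) :
    ((c : MonoidAlgebra ℤ G) * x).coeff g = c * x.coeff g := by
  rw [← zsmul_eq_mul, coeff_smul_apply, smul_eq_mul]

theorem intCast_mul_left_cancel {c : ℤ} (hc : c ≠ 0) {x y : MonoidAlgebra ℤ G}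
    (h : (c : MonoidAlgebra ℤ G) * x = c * y) : x = y := by
  ext g
  have := congrArg (fun z => z.coeff g) h
  simp only [coeff_intCast_mul] at this
  exact mul_left_cancel₀ hc this

/-- The `p`-power map is a lift of Frobenius on the integral group ring. -/
theorem dvd_powHom_sub_pow {p : ℕ} (hp : p.Prime) (x : MonoidAlgebra ℤ G) :
    (p : MonoidAlgebra ℤ G) ∣ powHom G p x - x ^ p := by
  induction x using MonoidAlgebra.induction_linear with
  | zero => simp [hp.ne_zero]
  | add x y hx hy =>
    obtain ⟨r, hr⟩ := exists_add_pow_prime_eq hp x y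
    have : powHom G p (x + y) - (x + y) ^ p
        = (powHom G p x - x ^ p) + (powHom G p y - y ^ p) - p * (x * y * r) := by
      rw [map_add, hr]; ring
    rw [this]
    exact dvd_sub (dvd_add hx hy) (dvd_mul_right _ _)
  | single g r =>
    have : (p : ℤ) ∣ r - r ^ p := by
      have := Fact.mk hp
      rw [← ZMod.intCast_eq_intCast_iff_dvd_sub]
      simp
    obtain ⟨c, hc⟩ := this
    refine ⟨single (g ^ p) c, ?_⟩
    rw [powHom_single, single_pow, ← single_sub, hc, natCast_def, single_mul_single, one_mul]

theorem coeff_invHom (x : MonoidAlgebra ℤ G) (g : G) : (invHom G x).coeff g = x.coeff g⁻¹ := by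
  classical
  induction x using MonoidAlgebra.induction_linear with
  | zero => simp
  | add x y hx hy => simp [hx, hy]
  | single h r => simp only [invHom_single, coeff_single, Finsupp.single_apply, inv_eq_iff_eq_inv]

theorem coeff_one_mul_invHom [Fintype G] (x : MonoidAlgebra ℤ G) :
    (x * invHom G x).coeff 1 = ∑ g, x.coeff g ^ 2 := by
  classical
  rw [coeff_mul_antidiag x _ 1 (Finset.univ.image fun g : G => (g, g⁻¹))]
  · rw [Finset.sum_image fun a _ b _ h => (Prod.ext_iff.1 h).1]
    simp only [coeff_invHom, inv_inv, sq]
  · rintro ⟨a, b⟩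
    simp [mul_eq_one_iff_inv_eq]

/-- The elements of the integral group ring that are unitary are, up to sign, group elements. -/
theorem exists_eq_single_of_mul_invHom_eq_one [Finite G] {x : MonoidAlgebra ℤ G}
    (h : x * invHom G x = 1) : ∃ g : G, x = single g (aug G x) := by
  classical
  have := Fintype.ofFinite G
  -- Integer squares summing to 1 leave exactly one nonzero coefficient.
  have hsum : ∑ g, x.coeff g ^ 2 = 1 := by rw [← coeff_one_mul_invHom, h, coeff_one_one]
  obtain ⟨g, -, hg⟩ : ∃ g ∈ Finset.univ, x.coeff g ^ 2 ≠ 0 :=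
    Finset.exists_ne_zero_of_sum_ne_zero (by rw [hsum]; exact one_ne_zero)
  have hx : x = single g (x.coeff g) := by
    ext g'
    rw [coeff_single, Finsupp.single_apply]
    split_ifs with hgg
    · rw [hgg]
    · by_contra h0
      have h₁ : x.coeff g ^ 2 + x.coeff g' ^ 2 ≤ 1 := by
        rw [← hsum, ← Finset.sum_pair (f := fun g => x.coeff g ^ 2) hgg]
        exact Finset.sum_le_sum_of_subset_of_nonneg (Finset.subset_univ _)
          fun i _ _ => sq_nonneg _
      have h₂ := sq_nonneg (x.coeff g)
      have h₃ : 0 < x.coeff g' ^ 2 := by positivity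
      omega
  refine ⟨g, ?_⟩
  rw [hx]
  simp

/-! ### Group ring elements attached to subsets -/

theorem aug_groupRingElt (S : Finset G) : aug G (groupRingElt S) = S.card := by
  simp [groupRingElt]

theorem coeff_groupRingElt {M : Type*} [DecidableEq M] (S : Finset M) (g : M) :
    (groupRingElt S).coeff g = if g ∈ S then 1 else 0 := by
  simp [groupRingElt, coeff_sum, Finsupp.single_apply]

theorem groupRingElt_injective {M : Type*} :
    Function.Injective (groupRingElt : Finset M → MonoidAlgebra ℤ M) := by
  classical
  intro S T h
  ext g
  have := congrArg (fun x => x.coeff g) h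
  simp only [coeff_groupRingElt] at this
  by_cases h₁ : g ∈ S <;> by_cases h₂ : g ∈ T <;> simp_all

theorem mul_groupRingElt_univ [Fintype G] (x : MonoidAlgebra ℤ G) :
    x * groupRingElt Finset.univ
      = (aug G x : MonoidAlgebra ℤ G) * groupRingElt (Finset.univ : Finset G) := by
  induction x using MonoidAlgebra.induction_linear with
  | zero => simp
  | add x y hx hy => rw [add_mul, hx, hy, map_add, Int.cast_add, add_mul]
  | single g r =>
    rw [aug_single, groupRingElt, ← zsmul_eq_mul, Finset.mul_sum, Finset.smul_sum]
    simp only [single_mul_single, mul_one, smul_single, smul_eq_mul]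
    exact Fintype.sum_equiv (Equiv.mulLeft g) _ _ fun _ => rfl

theorem mapDomainRingHom_groupRingElt {H : Type*} [CommGroup H] [DecidableEq H] (π : G →* H)
    {S : Finset G} (h : Set.InjOn π S) :
    mapDomainRingHom ℤ π (groupRingElt S) = groupRingElt (S.image π) := by
  rw [groupRingElt, groupRingElt, Finset.sum_image h, map_sum]
  simp

theorem coeff_mapDomainRingHom_groupRingElt {H : Type*} [CommGroup H] [DecidableEq H] (π : G →* H)
    (S : Finset G) (h : H) :
    (mapDomainRingHom ℤ π (groupRingElt S)).coeff h = (S.filter (π · = h)).card := by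
  simp [groupRingElt, coeff_sum, Finsupp.single_apply]

theorem single_mul_groupRingElt [DecidableEq G] (g : G) (S : Finset G) :
    single g 1 * groupRingElt S = groupRingElt (S.image (g * ·)) := by
  rw [groupRingElt, groupRingElt, Finset.sum_image (mul_right_injective g).injOn, Finset.mul_sum]
  simp

theorem invHom_groupRingElt_univ [Fintype G] :
    invHom G (groupRingElt Finset.univ) = groupRingElt (Finset.univ : Finset G) := by
  classical
  rw [invHom, mapDomainRingHom_groupRingElt _ (by exact inv_injective.injOn)]
  congr 1
  exact Finset.image_univ_of_surjective inv_surjective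

theorem pow_injective_of_coprime [Fintype G] {p : ℕ} (h : (Fintype.card G).Coprime p) :
    Function.Injective fun g : G => g ^ p :=
  (powCoprime (by rwa [Nat.card_eq_fintype_card])).injective

theorem powHom_groupRingElt_univ [Fintype G] {p : ℕ} (h : (Fintype.card G).Coprime p) :
    powHom G p (groupRingElt Finset.univ) = groupRingElt (Finset.univ : Finset G) := by
  classical
  rw [powHom, mapDomainRingHom_groupRingElt _ (pow_injective_of_coprime h).injOn]
  congr 1
  exact Finset.image_univ_of_surjective
    (Finite.surjective_of_injective (pow_injective_of_coprime h))

/-! ### The multiplier theorem for prime power order -/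

/-- If `k - l` is a power of a prime `p` coprime to the group order, then `p` is a multiplier:
the `p`-th powers of the elements of `D` form a translate of `D`. -/
theorem IsDifferenceSet.exists_powHom_eq [Fintype G] {D : Finset G} {v k l p a f : ℕ}
    (hD : IsDifferenceSet D v k l) (hp : p.Prime) (hn : (k : ℤ) - l = p ^ a)
    (hpv : v.Coprime p) (hf : 1 ≤ f) (hfv : ∀ g : G, g ^ p ^ f = g) :
    ∃ g : G, powHom G p (groupRingElt D) = single g 1 * groupRingElt D := by
  have heqn := hD.eqn
  rw [groupRingInv_eq, hn, zsmul_eq_mul, zsmul_eq_mul, mul_one] at heqn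
  set d := groupRingElt D with hd
  set T := groupRingElt (Finset.univ : Finset G) with hT
  set φ := powHom G p with hφ
  have haugd : aug G d = k := by rw [hd, aug_groupRingElt, hD.card_set]
  have haugT : aug G T = v := by rw [hT, aug_groupRingElt, Finset.card_univ, hD.card_group]
  have hT' : ∀ x, x * T = (aug G x : MonoidAlgebra ℤ G) * T := mul_groupRingElt_univ
  have hφT : φ T = T := powHom_groupRingElt_univ (by rwa [hD.card_group])
  have hιT : invHom G T = T := invHom_groupRingElt_univ
  have hk : (k : ℤ) * k = l * v + p ^ a := by
    have := congrArg (aug G) heqn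
    simpa [haugT, haugd, aug_invHom] using this
  have hpa : (p : ℤ) ^ a ≠ 0 := pow_ne_zero _ (by exact_mod_cast hp.ne_zero)
  -- `d ^ (p) * d ^ (-1) - l T` is divisible by the order `p ^ a`
  obtain ⟨F, hF⟩ : ∃ F, φ d * invHom G d - (l : ℤ) * T = ((p ^ a : ℤ) : MonoidAlgebra ℤ G) * F := by
    obtain ⟨x, y, hxy⟩ := frobeniusLift_mem_span hp (dvd_powHom_sub_pow hp) hf
      (fun x => by rw [iterate_powHom, powHom_eq_self_of_forall_pow hfv]) a d
    have h₁ : φ d * invHom G d - (l : ℤ) * T = ((l * (aug G x - 1) : ℤ) : MonoidAlgebra ℤ G) * T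
        + ((p ^ a : ℤ) : MonoidAlgebra ℤ G) * (x + y * invHom G d) := by
      have := hT' x
      push_cast at heqn ⊢
      linear_combination (invHom G d) * hxy + x * heqn + (l : MonoidAlgebra ℤ G) * this
    -- The augmentation of `h₁`, with `k² - l v = p ^ a`, gives this divisibility after
    -- multiplication by `v`, which is prime to `p`.
    obtain ⟨c, hc⟩ : (p : ℤ) ^ a ∣ l * (aug G x - 1) := by
      have h₂ := congrArg (aug G) h₁
      simp only [map_sub, map_mul, map_add, map_intCast, haugT, aug_invHom, haugd, hφ,
        aug_powHom, Int.cast_id] at h₂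
      refine IsCoprime.dvd_of_dvd_mul_right
        (IsCoprime.pow_left (Nat.isCoprime_iff_coprime.2 hpv.symm) : IsCoprime ((p : ℤ) ^ a) v)
        ⟨1 - (aug G x + aug G y * k), ?_⟩
      linear_combination hk - h₂
    refine ⟨c * T + (x + y * invHom G d), ?_⟩
    rw [h₁, hc]
    push_cast
    ring
  have hFF : F * invHom G F = 1 := by
    apply intCast_mul_left_cancel hpa
    apply intCast_mul_left_cancel hpa
    have hιF := congrArg (invHom G) hF
    simp only [map_sub, map_mul, map_intCast, invHom_invHom, hιT] at hιF
    have hφeqn := congrArg φ heqn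
    simp only [map_add, map_mul, map_intCast, hφT] at hφeqn
    rw [hφ, ← invHom_powHom, ← hφ] at hφeqn
    have h₁ := hT' (φ d * invHom G d)
    have h₂ := hT' (invHom G (φ d) * d)
    have h₃ := hT' T
    simp only [map_mul, hφ, aug_invHom, aug_powHom, haugd, haugT] at h₁ h₂ h₃
    have hk' := congrArg (Int.cast : ℤ → MonoidAlgebra ℤ G) hk
    push_cast at *
    linear_combination -((p : MonoidAlgebra ℤ G) ^ a * invHom G F) * hF
      - (φ d * invHom G d - l * T) * hιF + (d * invHom G d) * hφeqn
      + (l * T + (p : MonoidAlgebra ℤ G) ^ a) * heqn - l * h₁ - l * h₂ + 2 * l ^ 2 * h₃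
      - 2 * l * T * hk'
  obtain ⟨g, hg⟩ := exists_eq_single_of_mul_invHom_eq_one hFF
  have haugF : aug G F = 1 := by
    have := congrArg (aug G) hF
    simp only [map_sub, map_mul, map_intCast, haugT, aug_invHom, haugd, hφ,
        aug_powHom, Int.cast_id] at this
    apply mul_left_cancel₀ hpa
    linear_combination hk - this
  rw [haugF] at hg
  refine ⟨g, ?_⟩
  apply intCast_mul_left_cancel hpa
  have h₁ := hT' (φ d)
  have h₂ := hT' d
  simp only [hφ, aug_powHom, haugd] at h₁ h₂
  rw [← hg]
  push_cast at *
  -- Multiplying `hF` by `d` and using `d * d⁻ = l T + p ^ a`, where `d⁻` is `invHom G d`, the terms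
  -- in `T` cancel because `d` and `φ d` have the same augmentation.
  linear_combination d * hF - φ d * heqn - l * h₁ + l * h₂

end GroupRing
end DiffSet

/-! ### Normalized difference sets and self-conjugacy of 2. -/

namespace DiffSet

open MonoidAlgebra

/-- A prime `p` that is a multiplier of `D`, as in `IsDifferenceSet.exists_powHom_eq`, fixes `D`
when `D` is normalized and `k` is coprime to `v`. -/
theorem IsDifferenceSet.powHom_eq_self {G : Type*} [CommGroup G] [Fintype G] {D : Finset G}
    {v k l p a f : ℕ} (hD : IsDifferenceSet D v k l) (hnorm : IsNormalized D) (hp : p.Prime)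
    (hn : (k : ℤ) - l = p ^ a) (hpv : v.Coprime p) (hkv : v.Coprime k) (hf : 1 ≤ f)
    (hfv : ∀ g : G, g ^ p ^ f = g) : powHom G p (groupRingElt D) = groupRingElt D := by
  classical
  obtain ⟨g, hg⟩ := hD.exists_powHom_eq hp hn hpv hf hfv
  have hinj : Function.Injective (powMonoidHom p : G →* G) :=
    pow_injective_of_coprime (G := G) (p := p) (by rwa [hD.card_group])
  have h := hg
  rw [powHom, mapDomainRingHom_groupRingElt _ hinj.injOn, single_mul_groupRingElt] at h
  have h := congrArg (fun S : Finset G => ∏ x ∈ S, x) (groupRingElt_injective h)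
  rw [Finset.prod_image hinj.injOn, Finset.prod_image (mul_right_injective g).injOn] at h
  simp only [powMonoidHom_apply] at h
  rw [Finset.prod_pow, Finset.prod_mul_distrib, Finset.prod_const, hD.card_set,
    show ∏ x ∈ D, x = 1 from hnorm, one_pow, mul_one] at h
  -- Comparing the products of all elements of the two sets gives `g ^ k = 1`.
  have hg1 : g = 1 :=
    pow_injective_of_coprime (G := G) (p := k) (by rwa [hD.card_group]) (by simp [← h])
  rw [hg, hg1, ← one_def, one_mul]

/-- If `2 ^ m ≡ -1` modulo the exponent of `W`, an element of `ℤW` that is fixed by the squaring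
map and whose square is `4 ^ s` is `± 2 ^ s`. -/
theorem eq_intCast_of_sq_eq {W : Type*} [CommGroup W] [Finite W] {m : ℕ}
    (hm : ∀ w : W, w ^ 2 ^ m = w⁻¹) (s : ℕ) {x : MonoidAlgebra ℤ W}
    (hfix : powHom W 2 x = x) (hsq : x * invHom W x = ((4 ^ s : ℤ) : MonoidAlgebra ℤ W)) :
    x = (aug W x : MonoidAlgebra ℤ W) := by
  have hinv : ∀ y, powHom W 2 y = y → invHom W y = y := fun y hy => by
    rw [← powHom_eq_invHom_of_forall_pow hm, ← iterate_powHom]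
    exact Function.iterate_fixed hy m
  induction s generalizing x with
  | zero =>
    obtain ⟨g, hg⟩ := exists_eq_single_of_mul_invHom_eq_one (x := x) (by simpa using hsq)
    have h0 : aug W x ≠ 0 := by
      intro h0
      rw [h0, single_zero] at hg
      rw [hg] at hsq
      simp at hsq
    have hg1 : g = 1 := by
      rw [hg, powHom_single, ← hg] at hfix
      simpa [sq] using (single_left_inj h0).1 (hfix.trans hg)
    conv_lhs => rw [hg, hg1]
    rw [intCast_def]
    rfl
  | succ s ih =>
    obtain ⟨y, hy⟩ := dvd_powHom_sub_pow Nat.prime_two x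
    rw [hfix] at hy
    rw [hinv x hfix] at hsq
    push_cast at hy hsq
    -- Modulo 2, `x` is congruent to `x ^ 2 = 4 ^ (s + 1)`, hence to 0; halving `x` lowers `s` by
    -- one.
    have h2 : x = ((2 : ℤ) : MonoidAlgebra ℤ W) * (y + 2 * 4 ^ s) := by
      push_cast
      linear_combination hy + hsq
    set z := y + 2 * 4 ^ s
    have hz : powHom W 2 z = z := by
      apply intCast_mul_left_cancel (c := 2) two_ne_zero
      rw [← h2, ← map_intCast (powHom W 2), ← map_mul, ← h2, hfix]
    have := ih (x := z) hz (by
      rw [hinv z hz]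
      apply intCast_mul_left_cancel (c := 4) four_ne_zero
      rw [h2] at hsq
      push_cast at hsq ⊢
      linear_combination hsq)
    rw [h2, map_mul, map_intCast, Int.cast_mul, ← this]
    simp

/-! ### Images of difference sets in quotient groups. -/

section Quotient

variable {G W : Type*} [CommGroup G] [CommGroup W]

theorem mapDomainRingHom_powHom (π : G →* W) (n : ℕ) (x : MonoidAlgebra ℤ G) :
    mapDomainRingHom ℤ π (powHom G n x) = powHom W n (mapDomainRingHom ℤ π x) := by
  have : (mapDomainRingHom ℤ π).comp (powHom G n) = (powHom W n).comp (mapDomainRingHom ℤ π) :=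
    ringHom_ext_single fun x => by simp
  exact DFunLike.congr_fun this x

theorem mapDomainRingHom_invHom (π : G →* W) (x : MonoidAlgebra ℤ G) :
    mapDomainRingHom ℤ π (invHom G x) = invHom W (mapDomainRingHom ℤ π x) := by
  have : (mapDomainRingHom ℤ π).comp (invHom G) = (invHom W).comp (mapDomainRingHom ℤ π) :=
    ringHom_ext_single fun x => by simp
  exact DFunLike.congr_fun this x

theorem aug_mapDomainRingHom (π : G →* W) (x : MonoidAlgebra ℤ G) :
    aug W (mapDomainRingHom ℤ π x) = aug G x := by
  have : (aug W).comp (mapDomainRingHom ℤ π) = aug G := ringHom_ext_single fun x => by simp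
  exact DFunLike.congr_fun this x

variable [Fintype G] [Fintype W]

theorem mapDomainRingHom_groupRingElt_univ {π : G →* W} (hπ : Function.Surjective π) :
    mapDomainRingHom ℤ π (groupRingElt Finset.univ)
      = (Nat.card π.ker : MonoidAlgebra ℤ W) * groupRingElt Finset.univ := by
  classical
  ext w
  obtain ⟨g, rfl⟩ := hπ w
  rw [coeff_mapDomainRingHom_groupRingElt, ← Int.cast_natCast (R := MonoidAlgebra ℤ W),
    coeff_intCast_mul, coeff_groupRingElt, if_pos (Finset.mem_univ _), mul_one]
  congr 1
  rw [← Nat.card_congr (MonoidHom.fiberEquivKer π g)]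
  exact (Nat.subtype_card _ (by simp)).symm

/-- The image of a difference set fixed by squaring in a quotient of order `2 ^ m + 1`: if `c` is
such that `(k - c (2 ^ m + 1)) ^ 2 = k - l = 4 ^ s`, then every coset other than the kernel meets
`D` in exactly `c` elements. -/
theorem IsDifferenceSet.card_fiber {D : Finset G} {v k l m s : ℕ} (hD : IsDifferenceSet D v k l)
    (hfix : powHom G 2 (groupRingElt D) = groupRingElt D) (hn : (k : ℤ) - l = 4 ^ s)
    {π : G →* W} (hπ : Function.Surjective π) (hm : 1 ≤ m) (hW : Fintype.card W = 2 ^ m + 1)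
    {c : ℤ} (hc : (k - c * (2 ^ m + 1)) ^ 2 = (4 : ℤ) ^ s) [DecidableEq W] (w : W) :
    ((D.filter (π · = w)).card : ℤ) = c + if w = 1 then k - c * (2 ^ m + 1) else 0 := by
  have heqn := congrArg (mapDomainRingHom ℤ π) hD.eqn
  rw [groupRingInv_eq, hn, zsmul_eq_mul, zsmul_eq_mul, mul_one] at heqn
  simp only [map_add, map_mul, map_intCast, mapDomainRingHom_groupRingElt_univ hπ,
    mapDomainRingHom_invHom] at heqn
  have hfix' := congrArg (mapDomainRingHom ℤ π) hfix
  rw [mapDomainRingHom_powHom] at hfix'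
  rw [← coeff_mapDomainRingHom_groupRingElt]
  set d := mapDomainRingHom ℤ π (groupRingElt D) with hd
  set T := groupRingElt (Finset.univ : Finset W) with hT
  have haugd : aug W d = k := by rw [hd, aug_mapDomainRingHom, aug_groupRingElt, hD.card_set]
  have haugT : aug W T = 2 ^ m + 1 := by
    rw [hT, aug_groupRingElt, Finset.card_univ, hW]; push_cast; rfl
  have hT' : ∀ x, x * T = (aug W x : MonoidAlgebra ℤ W) * T := mul_groupRingElt_univ
  have hφT : powHom W 2 T = T := powHom_groupRingElt_univ (by
    rw [hW, Nat.coprime_two_right, Nat.odd_add_one, Nat.not_odd_iff_even]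
    exact (even_two).pow_of_ne_zero (by omega))
  have hιT : invHom W T = T := invHom_groupRingElt_univ
  have hk : (k : ℤ) * k = l * (Nat.card π.ker * (2 ^ m + 1)) + 4 ^ s := by
    have := congrArg (aug W) heqn
    simpa only [map_add, map_mul, map_intCast, map_natCast, haugT, haugd, aug_invHom,
      Int.cast_id] using this
  have key := eq_intCast_of_sq_eq (W := W) (m := m) (x := d - c * T)
    (fun w => eq_inv_of_mul_eq_one_left (by rw [← pow_succ, ← hW, pow_card_eq_one])) s
    (by rw [map_sub, map_mul, map_intCast, hφT, hfix']) (by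
      have h₁ := hT' d
      have h₂ := hT' (invHom W d)
      have h₃ := hT' T
      rw [aug_invHom] at h₂
      rw [haugd] at h₁ h₂
      rw [haugT] at h₃
      -- This is the coefficient of `T` in the square of `d - c * T`; the hypothesis on `c` is what
      -- makes it vanish.
      have hcoef : (l * Nat.card π.ker - 2 * c * k + c ^ 2 * (2 ^ m + 1) : ℤ) = 0 := by
        have : (2 ^ m + 1 : ℤ) ≠ 0 := by positivity
        apply mul_left_cancel₀ this
        linear_combination hc - hk
      have hcoef' := congrArg (Int.cast : ℤ → MonoidAlgebra ℤ W) hcoef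
      simp only [map_sub, map_mul, map_intCast, hιT]
      push_cast at *
      linear_combination heqn - c * h₁ - c * h₂ + c ^ 2 * h₃ + T * hcoef')
  have haug : aug W (d - c * T) = k - c * (2 ^ m + 1) := by
    rw [map_sub, map_mul, map_intCast, haugd, haugT, Int.cast_id]
  rw [haug, sub_eq_iff_eq_add] at key
  rw [key, coeff_add, Finsupp.add_apply, coeff_intCast_mul, hT, coeff_groupRingElt,
    if_pos (Finset.mem_univ _), mul_one, add_comm, intCast_def, coeff_single, Finsupp.single_apply]
  simp [eq_comm]

end Quotient

/-! ### Subgroups of coprime order. -/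

/-- A finite abelian group whose order is a product of coprime numbers `a` and `b` has a subgroup
of order `a`. -/
theorem exists_subgroup_card_of_coprime {G : Type*} [CommGroup G] [Finite G] {a b : ℕ}
    (hG : Nat.card G = a * b) (hab : a.Coprime b) : ∃ H : Subgroup G, Nat.card H = a := by
  refine ⟨(powMonoidHom a : G →* G).ker, ?_⟩
  have hmul : Nat.card (powMonoidHom a : G →* G).ker * Nat.card (powMonoidHom a : G →* G).range
      = a * b := by
    rw [← hG, ← Subgroup.card_mul_index (powMonoidHom a : G →* G).ker, Subgroup.index_ker]
  -- The kernel is killed by `a`, so its order divides a power of `a` and is prime to `b`;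
  -- symmetrically, the image is killed by `b`.
  have hk : Nat.card (powMonoidHom a : G →* G).ker ∣ a := by
    have h := card_dvd_exponent_pow_rank' (G := (powMonoidHom a : G →* G).ker) (n := a)
      fun g => Subtype.ext (MonoidHom.mem_ker.1 g.2)
    exact ((hab.pow_left _).coprime_dvd_left h).dvd_of_dvd_mul_right
      (hmul ▸ dvd_mul_right _ _)
  have hr : Nat.card (powMonoidHom a : G →* G).range ∣ b := by
    have h := card_dvd_exponent_pow_rank' (G := (powMonoidHom a : G →* G).range) (n := b) (by
      rintro ⟨_, g, rfl⟩
      refine Subtype.ext ?_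
      simp [← pow_mul, ← hG])
    exact ((hab.symm.pow_left _).coprime_dvd_left h).dvd_of_dvd_mul_left
      (hmul ▸ dvd_mul_left _ _)
  have ha : 0 < Nat.card (powMonoidHom a : G →* G).ker := Nat.card_pos
  have hb : 0 < b := by
    rcases Nat.eq_zero_or_pos b with rfl | h
    · simp [Nat.card_pos.ne'] at hG
    · exact h
  refine Nat.dvd_antisymm hk ?_
  obtain ⟨c, hc⟩ := hr
  refine ⟨c, Nat.eq_of_mul_eq_mul_right (Nat.card_pos (α := (powMonoidHom a : G →* G).range)) ?_⟩
  rw [hmul, hc]; ring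

end DiffSet

/-! ### Intersections of `D` with cosets. -/

namespace DiffSet

theorem ncard_inter_rightCoset {G : Type*} [CommGroup G] [DecidableEq G] (D : Finset G)
    (L : Subgroup G) [DecidableEq (G ⧸ L)] (x : G) :
    ((D : Set G) ∩ MulOpposite.op x • (L : Set G)).ncard
      = (D.filter (QuotientGroup.mk' L · = QuotientGroup.mk' L x)).card := by
  rw [← Set.ncard_coe_finset]
  congr 1
  ext g
  have h : QuotientGroup.mk' L g = QuotientGroup.mk' L x ↔ g * x⁻¹ ∈ L := by
    rw [QuotientGroup.mk'_apply, QuotientGroup.mk'_apply, eq_comm, QuotientGroup.eq, mul_comm]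
  rw [Finset.mem_coe, Finset.mem_filter, h, Set.mem_inter_iff, mem_rightCoset_iff, Finset.mem_coe,
    SetLike.mem_coe]

/-- The intersection numbers of a difference set fixed by squaring with the cosets of a subgroup
`L` of index `2 ^ m + 1`. -/
theorem IsDifferenceSet.ncard_inter {G : Type*} [CommGroup G] [Fintype G] {D : Finset G}
    {v k l m s : ℕ} (hD : IsDifferenceSet D v k l)
    (hfix : powHom G 2 (groupRingElt D) = groupRingElt D) (hn : (k : ℤ) - l = 4 ^ s)
    (hm : 1 ≤ m) {L : Subgroup G} (hL : L.index = 2 ^ m + 1)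
    {c : ℤ} (hc : (k - c * (2 ^ m + 1)) ^ 2 = (4 : ℤ) ^ s) (x : G) :
    ((x ∉ L) → (((D : Set G) ∩ MulOpposite.op x • (L : Set G)).ncard : ℤ) = c) ∧
    (((D : Set G) ∩ (L : Set G)).ncard : ℤ) = c + (k - c * (2 ^ m + 1)) := by
  classical
  have := Fintype.ofFinite (G ⧸ L)
  have hW : Fintype.card (G ⧸ L) = 2 ^ m + 1 := by
    rw [← Nat.card_eq_fintype_card, ← hL, Subgroup.index]
  have h := hD.card_fiber hfix hn (QuotientGroup.mk'_surjective L) hm hW hc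
  constructor
  · intro hx
    rw [ncard_inter_rightCoset, h, if_neg, add_zero]
    rwa [QuotientGroup.mk'_apply, QuotientGroup.eq_one_iff]
  · have h₁ := ncard_inter_rightCoset D L 1
    rw [MulOpposite.op_one, one_smul] at h₁
    rw [h₁, h, map_one, if_pos rfl]

theorem pow_mem_of_powHom_eq_self {G : Type*} [CommGroup G] {D : Finset G} {n : ℕ}
    (hinj : Function.Injective fun g : G => g ^ n)
    (hfix : powHom G n (groupRingElt D) = groupRingElt D) {d : G} (hd : d ∈ D) : d ^ n ∈ D := by
  classical
  have hinj' : Function.Injective (powMonoidHom n : G →* G) := hinj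
  rw [powHom, mapDomainRingHom_groupRingElt _ hinj'.injOn] at hfix
  rw [← groupRingElt_injective hfix]
  exact Finset.mem_image_of_mem (powMonoidHom n : G →* G) hd

end DiffSet

open DiffSet in
/-- Here `MulOpposite.op x • (H : Set G)` is the right coset `Hx`; `H.IsComplement' K` says that
every element of `G` is uniquely a product `h * k` with `h ∈ H`, `k ∈ K`, i.e. that the abelian
group `G` is the (internal) direct product of `H` and `K`. -/
theorem corollary5p2 {G : Type*} [CommGroup G] [Fintype G] (s : ℕ) (hs : 1 ≤ s)
    (D : Finset G)
    (hD : DiffSet.IsDifferenceSet D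
      ((2 ^ s + 1) * (2 ^ (2 * s) + 1)) (2 ^ (2 * s) + 2 ^ s + 1) (2 ^ s + 1))
    (hnorm : DiffSet.IsNormalized D) :
    (∃ H K : Subgroup G, Nat.card H = 2 ^ s + 1 ∧ Nat.card K = 2 ^ (2 * s) + 1) ∧
    ∀ H K : Subgroup G, Nat.card H = 2 ^ s + 1 → Nat.card K = 2 ^ (2 * s) + 1 →
      H.IsComplement' K ∧
      (H : Set G) ⊆ (D : Set G) ∧
      (∀ x : G, x ∉ H →
        ((D : Set G) ∩ MulOpposite.op x • (H : Set G)).ncard = 1) ∧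
      (D : Set G) ∩ (K : Set G) = {1} ∧
      (∀ x : G, x ∉ K →
        ((D : Set G) ∩ MulOpposite.op x • (K : Set G)).ncard = 2 ^ s + 1) := by
  have hcard : Nat.card G = (2 ^ s + 1) * (2 ^ (2 * s) + 1) := by
    rw [Nat.card_eq_fintype_card, hD.card_group]
  have hq2 : 2 ^ (2 * s) = 2 ^ s * 2 ^ s := by rw [two_mul, pow_add]
  have hq4 : (4 : ℤ) ^ s = 2 ^ s * 2 ^ s := by rw [← mul_pow]; norm_num
  have hev : Even (2 ^ s) := even_two.pow_of_ne_zero (by omega)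
  have hcop : (2 ^ s + 1).Coprime (2 ^ (2 * s) + 1) := by
    have h2 : (2 ^ s + 1).Coprime 2 := Nat.coprime_two_right.2 hev.add_one
    obtain ⟨r, hr⟩ := Nat.exists_eq_add_of_le (Nat.one_le_two_pow (n := s))
    rwa [show 2 ^ (2 * s) + 1 = 2 + (2 ^ s + 1) * r by rw [hq2, hr]; ring,
      Nat.coprime_add_mul_left_right]
  have hv2 : ((2 ^ s + 1) * (2 ^ (2 * s) + 1)).Coprime 2 := by
    rw [Nat.coprime_two_right]
    exact hev.add_one.mul (even_two.pow_of_ne_zero (by omega)).add_one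
  have hvk : ((2 ^ s + 1) * (2 ^ (2 * s) + 1)).Coprime (2 ^ (2 * s) + 2 ^ s + 1) := by
    refine Nat.Coprime.mul_left ?_ ?_
    · rw [hq2, show 2 ^ s * 2 ^ s + 2 ^ s + 1 = 1 + (2 ^ s + 1) * 2 ^ s by ring]
      simp
    · rw [show 2 ^ (2 * s) + 2 ^ s + 1 = 2 ^ s + (2 ^ (2 * s) + 1) by ring,
        Nat.coprime_add_self_right, hq2]
      simp
  have hord : ∀ g : G, g ^ 2 ^ (4 * s) = g := fun g => by
    have h1 : 1 ≤ 2 ^ s := Nat.one_le_two_pow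
    -- With `q = 2 ^ s`, `q ^ 4 - 1 = v (q - 1)`, so squaring has order dividing `4 * s` on `G`.
    have h4 : 2 ^ (4 * s) = (2 ^ s + 1) * (2 ^ (2 * s) + 1) * (2 ^ s - 1) + 1 := by
      obtain ⟨r, hr⟩ := Nat.exists_eq_add_of_le h1
      rw [show 4 * s = s + s + (s + s) by ring, pow_add, pow_add, hq2, hr, Nat.add_sub_cancel_left]
      ring
    rw [h4, pow_succ, pow_mul, ← hcard, pow_card_eq_one', one_pow, one_mul]
  have hfix := hD.powHom_eq_self hnorm Nat.prime_two (a := 2 * s) (by push_cast; ring) hv2 hvk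
    (by omega) hord
  have hn : ((2 ^ (2 * s) + 2 ^ s + 1 : ℕ) : ℤ) - (2 ^ s + 1 : ℕ) = 4 ^ s := by
    rw [hq2, hq4]; push_cast; ring
  constructor
  · obtain ⟨H, hH⟩ := exists_subgroup_card_of_coprime hcard hcop
    obtain ⟨K, hK⟩ := exists_subgroup_card_of_coprime (hcard.trans (mul_comm _ _)) hcop.symm
    exact ⟨H, K, hH, hK⟩
  intro H K hH hK
  have hHi : H.index = 2 ^ (2 * s) + 1 := by
    have := H.card_mul_index
    rw [hH, hcard] at this
    exact Nat.eq_of_mul_eq_mul_left (by positivity) this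
  have hKi : K.index = 2 ^ s + 1 := by
    have := K.card_mul_index
    rw [hK, hcard, mul_comm] at this
    exact Nat.eq_of_mul_eq_mul_right (by positivity) this
  -- Here `k - c (2 ^ (2 * s) + 1) = 2 ^ s`, so `D` meets `H` in `1 + 2 ^ s` points, which is all of
  -- `H`.
  have hDH := hD.ncard_inter hfix hn (by omega) hHi (c := 1) (by
    rw [hq2, hq4, show 2 * s = s + s by ring, pow_add]; push_cast; ring)
  -- Here the root is negative: `k - (2 ^ s + 1) ^ 2 = -2 ^ s`, leaving a single point in `K`.
  have hDK := hD.ncard_inter hfix hn hs hKi (c := 2 ^ s + 1) (by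
    rw [hq2, hq4]; push_cast; ring)
  refine ⟨Subgroup.isComplement'_of_coprime (by rw [hH, hK, hcard]) (by rwa [hH, hK]), ?_,
    fun x hx => by exact_mod_cast (hDH x).1 hx, ?_, fun x hx => by exact_mod_cast (hDK x).1 hx⟩
  · have h := (hDH 1).2
    rw [← Set.inter_eq_right]
    refine Set.eq_of_subset_of_ncard_le Set.inter_subset_right ?_
    rw [← Nat.card_coe_set_eq (H : Set G), SetLike.coe_sort_coe, hH]
    zify
    rw [h]
    push_cast
    linarith
  · have h : ((D : Set G) ∩ K).ncard = 1 := by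
      zify
      rw [(hDK 1).2]
      push_cast
      rw [show 2 * s = s + s by ring, pow_add]
      ring
    obtain ⟨d, hd⟩ := Set.ncard_eq_one.1 h
    have hdm : d ∈ (D : Set G) ∩ K := hd ▸ Set.mem_singleton d
    -- Squaring preserves both `D` and `K`, so it fixes their only common point, which is then 1.
    have hdd : d ^ 2 ∈ (D : Set G) ∩ K :=
      ⟨pow_mem_of_powHom_eq_self (pow_injective_of_coprime (by rwa [hD.card_group])) hfix hdm.1,
        K.pow_mem hdm.2 2⟩
    rw [hd, Set.mem_singleton_iff, sq, mul_eq_left] at hdd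
    rw [hd, hdd]
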